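/- Let $H$ be the Hadamard gate, $T=\mathrm{diag}(1,e^{i\pi/4})$ the $\pi/8$ gate and, for $k\ge 1$, let the unbounded Toffoli gate with $k$ controls be the $(k+1)$-qubit gate $|c_1,\dots,c_k,t\rangle\mapsto|c_1,\dots,c_k,\,t\oplus(c_1\wedge\dots\wedge c_k)\rangle$; CNOT is the case $k=1$. The size of a quantum circuit is its number of gates. There are a constant $K$ and a family of quantum circuits $(U_{n,c})_{n,c\ge 1}$, where $U_{n,c}$ acts on $n+m$ qubits for some $m=m(n,c)\ge 0$, such that for all $n,c\ge 1$: (i) $U_{n,c}$ is universal for the circuits of size at most $c$ on $n$ qubits consisting of Hadamard, $\pi/8$ and unbounded Toffoli gates (with any numbers of controls): for every such circuit $C$ there is a string $x\in\{0,1\}^m$ with $U_{n,c}(|y\rangle\otimes|x\rangle)=C|y\rangle\otimes|x\rangle$ for all $y\in\{0,1\}^n$; (ii) $U_{n,c}$ uses only the gates $H$, $T$ and CNOT (which belong to the same gate family); (iii) the size of $U_{n,c}$ is at most $K\,nc\log(nc)$ whenever $nc\ge 2$; that is, $\mathrm{SIZE}(U_{n,c})=O(nc\log(nc))$. -/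

import Mathlib

open scoped Matrix

noncomputable section

namespace QCircuit

/-- Computational basis labels of `N` qubits: bit strings of length `N`. -/
abbrev Bits (N : ℕ) : Type := Fin N → Bool

/-- State vectors of `N` qubits, as amplitude functions in the computational basis. -/
abbrev StateVec (N : ℕ) : Type := Bits N → ℂ

/-- Operators on `N` qubits; the entry `A x y` is `⟨x| A |y⟩`. -/
abbrev Operator (N : ℕ) : Type := Matrix (Bits N) (Bits N) ℂ

/-- The basis state `|x⟩`. -/
def ket {N : ℕ} (x : Bits N) : StateVec N := Pi.single x 1

/-- The tensor product `v ⊗ w` of a state of the first `n` qubits and a state of the last `m`. -/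
def tensor {n m : ℕ} (v : StateVec n) (w : StateVec m) : StateVec (n + m) :=
  fun z => v (fun i => z (Fin.castAdd m i)) * w (fun j => z (Fin.natAdd n j))

/-- The `2 × 2` Hadamard matrix. -/
def hadamardMatrix : Matrix Bool Bool ℂ :=
  fun a b => if a && b then -(1 / (Real.sqrt 2 : ℂ)) else 1 / (Real.sqrt 2 : ℂ)

/-- The `2 × 2` matrix `diag (1, exp (i π / 4))` of the `π/8` gate `T`. -/
def tMatrix : Matrix Bool Bool ℂ :=
  Matrix.diagonal fun b => if b then Complex.exp (Complex.I * Real.pi / 4) else 1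

/-- The single-qubit operator `A` acting on qubit `i` of `N`, identity on the other qubits. -/
def onQubit {N : ℕ} (A : Matrix Bool Bool ℂ) (i : Fin N) : Operator N :=
  fun x y => if ∀ j, j ≠ i → x j = y j then A (x i) (y i) else 0

/-- The classical action of a Toffoli gate: the target bit is flipped iff all controls are `1`. -/
def toffoliMap {N : ℕ} (ctrl : Finset (Fin N)) (tgt : Fin N) (y : Bits N) : Bits N :=
  Function.update y tgt (xor (y tgt) (decide (∀ i ∈ ctrl, y i = true)))

/-- The Toffoli operator `|y⟩ ↦ |toffoliMap y⟩`. -/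
def toffoliOp {N : ℕ} (ctrl : Finset (Fin N)) (tgt : Fin N) : Operator N :=
  fun x y => if x = toffoliMap ctrl tgt y then 1 else 0

/-- Gates placed on `N` qubits: Hadamard, `π/8`, and unbounded Toffoli gates with any number
`k ≥ 1` of control qubits and a target qubit different from the controls. The gate is symmetric
in its controls, so they are given by a finite set. -/
inductive Gate (N : ℕ) : Type
  | hadamard (i : Fin N) : Gate N
  | piEighth (i : Fin N) : Gate N
  | toffoli (ctrl : Finset (Fin N)) (tgt : Fin N) (hne : ctrl.Nonempty) (ht : tgt ∉ ctrl) : Gate N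

/-- The operator of a placed gate. -/
def Gate.op {N : ℕ} : Gate N → Operator N
  | .hadamard i => onQubit hadamardMatrix i
  | .piEighth i => onQubit tMatrix i
  | .toffoli ctrl tgt _ _ => toffoliOp ctrl tgt

/-- The width of a gate: the number of qubits it acts upon. The gates of width at most `2` are
the Hadamard gates, the `π/8` gates and the Toffoli gates with one control (CNOT). -/
def Gate.width {N : ℕ} : Gate N → ℕ
  | .hadamard _ => 1
  | .piEighth _ => 1
  | .toffoli ctrl _ _ _ => ctrl.card + 1

/-- A circuit on `N` qubits: its gates in the order in which they are applied. -/
abbrev Circuit (N : ℕ) : Type := List (Gate N)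

/-- The size of a circuit is its number of gates. -/
def Circuit.size {N : ℕ} (C : Circuit N) : ℕ := List.length C

/-- The operator of a circuit; the head of the list is applied first. -/
def Circuit.op {N : ℕ} : Circuit N → Operator N
  | [] => 1
  | g :: C => Circuit.op C * g.op

/-- `U`, on `n` data and `m` encoding qubits, is universal for the collection `𝒞` of circuits on
`n` qubits: each `C ∈ 𝒞` has an encoding `x` with `U (|y⟩ ⊗ |x⟩) = C |y⟩ ⊗ |x⟩` for all `y`. -/
def IsUniversal {n m : ℕ} (U : Circuit (n + m)) (𝒞 : Set (Circuit n)) : Prop :=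
  ∀ C ∈ 𝒞, ∃ x : Bits m, ∀ y : Bits n,
    Circuit.op U *ᵥ tensor (ket y) (ket x) = tensor (Circuit.op C *ᵥ ket y) (ket x)

end QCircuit

end

open scoped Matrix

noncomputable section

namespace QCircuit

/-! ### Action of single gates on basis states and on one-qubit slices. -/

section Circuits

variable {N : ℕ}

/-! The universal circuit has `c` time steps, and in each step every qubit is offered every kind of
gate. Encoding bits select the gate that takes effect. All other slots act as the identity, so
circuits shorter than `c` are padded with empty steps.

A controlled Hadamard gate is a short word in H, T and CNOT (`op_controlledH_mulVec_ket`). A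
controlled T gate computes "select bit and data bit" on a scratch wire, applies T there and
uncomputes. For an unbounded Toffoli gate, a chain of work wires accumulates the conjunction over
all `i` of "`i` is not a control, or data bit `i` is 1". The last link, together with the target
bits, flips the data, and the chain is then run backwards (`run_toffoliGates`). This uses only CNOT
and two-control Toffoli gates, and the latter are built from H, T and CNOT (`op_ccx_mulVec_ket`).

Every step restores the encoding and work wires, whose initial constants are part of `x`, so the
steps compose on arbitrary data superpositions (`Implements`). A step costs O(n) gates, so the total
is O(nc), stronger than the required O(nc log(nc)). -/

theorem mulVec_ket (A : Operator N) (z : Bits N) : A *ᵥ ket z = fun x => A x z := by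
  ext x
  simp [ket, Matrix.col_apply]

/-- The state of `N` qubits that agrees with `|z⟩` away from qubit `i`, which is in state `u`. -/
def slice (z : Bits N) (i : Fin N) (u : Bool → ℂ) : StateVec N :=
  ∑ b, u b • ket (Function.update z i b)

theorem ket_eq_slice (z : Bits N) (i : Fin N) : ket z = slice z i (Pi.single (z i) 1) := by
  cases h : z i <;> simp [slice, ← h]

theorem onQubit_mulVec_ket (A : Matrix Bool Bool ℂ) (i : Fin N) (z : Bits N) :
    onQubit A i *ᵥ ket z = slice z i (fun b => A b (z i)) := by
  rw [mulVec_ket]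
  ext x
  have key : ∀ b, x = Function.update z i b ↔ (b = x i ∧ ∀ j, j ≠ i → x j = z j) := by
    intro b
    constructor
    · rintro rfl
      simp +contextual
    · rintro ⟨rfl, h⟩
      ext j
      by_cases hj : j = i
      · subst hj; simp
      · simp [hj, h j hj]
  simp only [slice, onQubit, Finset.sum_apply, Pi.smul_apply, ket, Pi.single_apply, key, smul_eq_mul]
  by_cases h : ∀ j, j ≠ i → x j = z j
  · have h' : (∀ j, j ≠ i → x j = z j) ↔ True := iff_true_intro h
    simp only [h', if_true, and_true]
    cases x i <;> simp
  · simp [h]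

/-- The basis states differing only at qubit `i` span a copy of ℂ² preserved by gates on `i`.
Identities for circuits that change a single target qubit thus become 2 × 2 computations. -/
theorem onQubit_mulVec_slice (A : Matrix Bool Bool ℂ) (i : Fin N) (z : Bits N) (u : Bool → ℂ) :
    onQubit A i *ᵥ slice z i u = slice z i (A *ᵥ u) := by
  have h : ∀ b, slice (Function.update z i b) i (fun b' => A b' b) =
      ∑ b', A b' b • ket (Function.update z i b') := by
    intro b; simp [slice]
  rw [slice, Matrix.mulVec_sum]
  simp only [Matrix.mulVec_smul, onQubit_mulVec_ket, Function.update_self, h]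
  simp only [slice, Fintype.sum_bool, Matrix.mulVec, dotProduct]
  module

theorem toffoliOp_mulVec_ket (S : Finset (Fin N)) (t : Fin N) (z : Bits N) :
    toffoliOp S t *ᵥ ket z = ket (toffoliMap S t z) := by
  rw [mulVec_ket]
  ext x
  simp [toffoliOp, ket, Pi.single_apply]

theorem sqrt_two_mul_self : (Real.sqrt 2 : ℂ) * Real.sqrt 2 = 2 := by
  rw [← Complex.ofReal_mul, Real.mul_self_sqrt (by norm_num)]; norm_num

theorem sqrt_two_ne_zero : (Real.sqrt 2 : ℂ) ≠ 0 := by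
  intro h
  have h2 := sqrt_two_mul_self
  rw [h] at h2
  norm_num at h2

/-- The number `exp (i π / 4)`. -/
def omega : ℂ := Complex.exp (Complex.I * Real.pi / 4)

theorem omega_eq : omega = (1 + Complex.I) / (Real.sqrt 2 : ℂ) := by
  have h2 := sqrt_two_mul_self
  have h0 := sqrt_two_ne_zero
  have : Complex.I * Real.pi / 4 = ((Real.pi / 4 : ℝ) : ℂ) * Complex.I := by push_cast; ring
  rw [omega, this, Complex.exp_mul_I, ← Complex.ofReal_cos, ← Complex.ofReal_sin,
    Real.cos_pi_div_four, Real.sin_pi_div_four, eq_div_iff h0]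
  push_cast
  linear_combination (1 / 2 + Complex.I / 2) * h2

theorem omega_sq : omega ^ 2 = Complex.I := by
  have : omega ^ 2 = Complex.exp (Real.pi / 2 * Complex.I) := by
    rw [omega, ← Complex.exp_nat_mul]; congr 1; push_cast; ring
  rw [this, Complex.exp_pi_div_two_mul_I]

theorem omega_pow_four : omega ^ 4 = -1 := by
  rw [show omega ^ 4 = (omega ^ 2) ^ 2 by ring, omega_sq, Complex.I_sq]

theorem omega_pow_eight : omega ^ 8 = 1 := by
  rw [show omega ^ 8 = (omega ^ 4) ^ 2 by ring, omega_pow_four]; norm_num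

/-- The phase that the `π/8` gate gives to a basis state. -/
def phase (b : Bool) : ℂ := if b then omega else 1

theorem tMatrix_eq : tMatrix = Matrix.diagonal phase := rfl

theorem onQubit_tMatrix_mulVec_ket (i : Fin N) (z : Bits N) :
    onQubit tMatrix i *ᵥ ket z = phase (z i) • ket z := by
  rw [onQubit_mulVec_ket]
  cases h : z i <;> simp [slice, tMatrix_eq, ← h, Matrix.diagonal_apply]

/-! ### Controlled gates as words in H, T and CNOT. -/

namespace Circuit

theorem op_append (C D : Circuit N) : op (C ++ D) = op D * op C := by
  induction C with
  | nil => simp [op]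
  | cons g C ih => simp [op, ih, mul_assoc]

theorem op_append_mulVec (C D : Circuit N) (v : StateVec N) :
    op (C ++ D) *ᵥ v = op D *ᵥ (op C *ᵥ v) := by
  rw [op_append, Matrix.mulVec_mulVec]

theorem op_cons_mulVec (g : Gate N) (C : Circuit N) (v : StateVec N) :
    op (g :: C) *ᵥ v = op C *ᵥ (g.op *ᵥ v) := by
  rw [op, Matrix.mulVec_mulVec]

theorem op_nil_mulVec (v : StateVec N) : op [] *ᵥ v = v := by
  simp [op]

theorem op_mulVec_slice (C : Circuit N) (z : Bits N) (i : Fin N) (u : Bool → ℂ) :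
    op C *ᵥ slice z i u = ∑ b, u b • (op C *ᵥ ket (Function.update z i b)) := by
  simp [slice, Matrix.mulVec_add, Matrix.mulVec_smul]

/-- The circuit of `k` successive `π/8` gates on one qubit. -/
def tPow (k : ℕ) (i : Fin N) : Circuit N := List.replicate k (.piEighth i)

theorem op_tPow_mulVec_ket (k : ℕ) (i : Fin N) (z : Bits N) :
    op (tPow k i) *ᵥ ket z = phase (z i) ^ k • ket z := by
  induction k with
  | zero => simp [tPow, op_nil_mulVec]
  | succ k ih =>
    rw [tPow] at ih
    rw [tPow, List.replicate_succ, op_cons_mulVec, Gate.op, onQubit_tMatrix_mulVec_ket,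
      Matrix.mulVec_smul, ih, smul_smul, pow_succ']

theorem op_tPow_mulVec_slice (k : ℕ) (i : Fin N) (z : Bits N) (u : Bool → ℂ) :
    op (tPow k i) *ᵥ slice z i u = slice z i (fun b => phase b ^ k * u b) := by
  rw [op_mulVec_slice]
  simp [op_tPow_mulVec_ket, slice, mul_comm, smul_smul]

/-- The CNOT gate with control `a` and target `t`. -/
def cnot (a t : Fin N) (h : a ≠ t) : Circuit N :=
  [.toffoli {a} t (Finset.singleton_nonempty a) (by simpa using h.symm)]

theorem op_cnot_mulVec_ket (a t : Fin N) (h : a ≠ t) (z : Bits N) :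
    op (cnot a t h) *ᵥ ket z = ket (Function.update z t (xor (z t) (z a))) := by
  rw [cnot, op_cons_mulVec, op_nil_mulVec, Gate.op, toffoliOp_mulVec_ket]
  simp [toffoliMap]

theorem op_cnot_mulVec_slice (a t : Fin N) (h : a ≠ t) (z : Bits N) (u : Bool → ℂ) :
    op (cnot a t h) *ᵥ slice z t u = slice z t (fun b => u (xor b (z a))) := by
  rw [op_mulVec_slice]
  simp only [op_cnot_mulVec_ket, slice, Function.update_self, Function.update_idem,
    Function.update_of_ne h, Fintype.sum_bool]
  cases z a <;> simp [add_comm]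

/-- Conjugation by a CNOT of a circuit acting diagonally. -/
theorem op_cnot_conj_mulVec_ket (a t : Fin N) (h : a ≠ t) (C : Circuit N) (f : Bits N → ℂ)
    (hC : ∀ z, op C *ᵥ ket z = f z • ket z) (z : Bits N) :
    op (cnot a t h ++ (C ++ cnot a t h)) *ᵥ ket z =
      f (Function.update z t (xor (z t) (z a))) • ket z := by
  rw [op_append_mulVec, op_append_mulVec, op_cnot_mulVec_ket, hC, Matrix.mulVec_smul,
    op_cnot_mulVec_ket]
  simp [Function.update_of_ne h]

theorem op_append_mulVec_ket_of_diagonal {C D : Circuit N} {f g : Bits N → ℂ}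
    (hC : ∀ z, op C *ᵥ ket z = f z • ket z) (hD : ∀ z, op D *ᵥ ket z = g z • ket z) (z : Bits N) :
    op (C ++ D) *ᵥ ket z = (f z * g z) • ket z := by
  rw [op_append_mulVec, hC, Matrix.mulVec_smul, hD, smul_smul]

/-- The doubly controlled `Z` gate. -/
def ccz (a b t : Fin N) (hab : a ≠ b) (hat : a ≠ t) (hbt : b ≠ t) : Circuit N :=
  tPow 1 a ++ (tPow 1 b ++ (tPow 1 t ++ ((cnot a b hab ++ (tPow 7 b ++ cnot a b hab)) ++
    ((cnot a t hat ++ (tPow 7 t ++ cnot a t hat)) ++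
      (cnot b t hbt ++ ((tPow 7 t ++ (cnot a t hat ++ (tPow 1 t ++ cnot a t hat))) ++
        cnot b t hbt))))))

/-- For bits, 4abt = a + b + t − (a⊕b) − (a⊕t) − (b⊕t) + (a⊕b⊕t). Each parity is formed by CNOT
conjugation and receives the phase ω or, through T⁷ = T⁻¹, ω⁻¹; the product is ω^(4abt) =
(−1)^(abt). -/
theorem op_ccz_mulVec_ket (a b t : Fin N) (hab : a ≠ b) (hat : a ≠ t) (hbt : b ≠ t) (z : Bits N) :
    op (ccz a b t hab hat hbt) *ᵥ ket z = (if z a && z b && z t then (-1 : ℂ) else 1) • ket z := by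
  have hT := op_tPow_mulVec_ket (N := N)
  have h := op_append_mulVec_ket_of_diagonal (hT 1 a) (op_append_mulVec_ket_of_diagonal (hT 1 b)
    (op_append_mulVec_ket_of_diagonal (hT 1 t) (op_append_mulVec_ket_of_diagonal
      (op_cnot_conj_mulVec_ket a b hab _ _ (hT 7 b)) (op_append_mulVec_ket_of_diagonal
        (op_cnot_conj_mulVec_ket a t hat _ _ (hT 7 t))
        (op_cnot_conj_mulVec_ket b t hbt _ _ (op_append_mulVec_ket_of_diagonal (hT 7 t)
          (op_cnot_conj_mulVec_ket a t hat _ _ (hT 1 t)))))))) z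
  rw [ccz, h]
  congr 1
  have e4 := omega_pow_four
  have e8 := omega_pow_eight
  simp only [Function.update_self, Function.update_of_ne hat]
  cases z a <;> cases z b <;> cases z t <;> simp [phase, ← pow_succ] <;> grind

/-- The Toffoli gate with two controls. -/
def ccx (a b t : Fin N) (hab : a ≠ b) (hat : a ≠ t) (hbt : b ≠ t) : Circuit N :=
  .hadamard t :: (ccz a b t hab hat hbt ++ [.hadamard t])

theorem hadamardMatrix_mulVec (u : Bool → ℂ) (b : Bool) : (hadamardMatrix *ᵥ u) b =
    1 / (Real.sqrt 2 : ℂ) * (u false + if b then -u true else u true) := by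
  cases b <;> simp [hadamardMatrix, Matrix.mulVec, dotProduct] <;> ring

/-- Conjugating by H on the target turns the conditional Z into a conditional X, since HZH = X and
HH = 1. -/
theorem op_ccx_mulVec_ket (a b t : Fin N) (hab : a ≠ b) (hat : a ≠ t) (hbt : b ≠ t) (z : Bits N) :
    op (ccx a b t hab hat hbt) *ᵥ ket z =
      ket (Function.update z t (xor (z t) (z a && z b))) := by
  have hz : ∀ u, op (ccz a b t hab hat hbt) *ᵥ slice z t u =
      slice z t (fun c => (if z a && z b && c then (-1 : ℂ) else 1) * u c) := by
    intro u
    rw [op_mulVec_slice]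
    simp only [op_ccz_mulVec_ket, slice, Function.update_self, Function.update_of_ne hat,
      Function.update_of_ne hbt, smul_smul, mul_comm]
  have h2 := sqrt_two_mul_self
  have h0 := sqrt_two_ne_zero
  rw [ccx, op_cons_mulVec, op_append_mulVec, Gate.op, ket_eq_slice z t, onQubit_mulVec_slice, hz,
    op_cons_mulVec, op_nil_mulVec, Gate.op, onQubit_mulVec_slice,
    ket_eq_slice (Function.update z t _) t]
  simp only [slice, Function.update_idem, Function.update_self]
  congr 1
  ext1 c
  congr 1
  simp only [hadamardMatrix_mulVec]
  cases z a <;> cases z b <;> cases z t <;> cases c <;> simp <;> field_simp <;>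
    linear_combination (-1 : ℂ) * h2

/-- The Hadamard gate on `t` controlled by `a`. -/
def controlledH (a t : Fin N) (h : a ≠ t) : Circuit N :=
  tPow 2 t ++ (.hadamard t :: (tPow 1 t ++ (cnot a t h ++ (tPow 7 t ++ (.hadamard t :: tPow 6 t)))))

/-- With control 0 the word is S†·H·T†·T·H·S = 1. With control 1 an X appears in the middle: T†XT =
(X − Y)/√2, conjugation by H gives (Z + Y)/√2, and conjugation by S gives (Z + X)/√2 = H. -/
theorem op_controlledH_mulVec_ket (a t : Fin N) (h : a ≠ t) (z : Bits N) :
    op (controlledH a t h) *ᵥ ket z =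
      if z a then onQubit hadamardMatrix t *ᵥ ket z else ket z := by
  have h2 := sqrt_two_mul_self
  have h0 := sqrt_two_ne_zero
  have e6 : omega ^ 6 = -Complex.I := by
    rw [show omega ^ 6 = omega ^ 2 * omega ^ 4 by ring, omega_sq, omega_pow_four]; ring
  have e7 : omega ^ 7 = (1 - Complex.I) / (Real.sqrt 2 : ℂ) := by
    rw [show omega ^ 7 = omega ^ 6 * omega by ring, e6, omega_eq]
    linear_combination (-1 / (Real.sqrt 2 : ℂ)) * Complex.I_sq
  have p1 : ∀ b, phase b ^ 1 = if b then (1 + Complex.I) / (Real.sqrt 2 : ℂ) else 1 := by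
    rintro (_ | _) <;> simp [phase, omega_eq]
  have p2 : ∀ b, phase b ^ 2 = if b then Complex.I else 1 := by
    rintro (_ | _) <;> simp [phase, omega_sq]
  have p6 : ∀ b, phase b ^ 6 = if b then -Complex.I else 1 := by
    rintro (_ | _) <;> simp [phase, e6]
  have p7 : ∀ b, phase b ^ 7 = if b then (1 - Complex.I) / (Real.sqrt 2 : ℂ) else 1 := by
    rintro (_ | _) <;> simp [phase, e7]
  rw [controlledH, op_append_mulVec, op_cons_mulVec, op_append_mulVec, op_append_mulVec,
    op_append_mulVec, op_cons_mulVec, Gate.op, ket_eq_slice z t, op_tPow_mulVec_slice,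
    onQubit_mulVec_slice, op_tPow_mulVec_slice, op_cnot_mulVec_slice, op_tPow_mulVec_slice,
    onQubit_mulVec_slice, op_tPow_mulVec_slice, onQubit_mulVec_slice]
  simp only [p1, p2, p6, p7]
  have hi := Complex.I_sq
  cases z a
  · simp only [Bool.false_eq_true, if_false]
    congr 1
    ext1 c
    simp only [hadamardMatrix_mulVec]
    cases z t <;> cases c <;> simp <;> field_simp <;>
      -- What remains are algebraic identities in ι and r with ι² = −1 and r² = 2.
      clear p1 p2 p6 p7 e6 e7 <;> generalize Complex.I = ι at * <;>
      generalize (Real.sqrt 2 : ℂ) = r at * <;> grind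
  · simp only [if_true]
    congr 1
    ext1 c
    simp only [hadamardMatrix_mulVec]
    cases z t <;> cases c <;> simp <;> field_simp <;>
      clear p1 p2 p6 p7 e6 e7 <;> generalize Complex.I = ι at * <;>
      generalize (Real.sqrt 2 : ℂ) = r at * <;> grind

end Circuit

end Circuits

/-! ### Classical reversible circuits on named wires. -/

/-- Classical reversible gates on a set of wires: CNOT and Toffoli gates with two controls. -/
inductive RevGate (W : Type) : Type
  | cx (a t : W) (h : a ≠ t) : RevGate W
  | ccx (a b t : W) (hab : a ≠ b) (hat : a ≠ t) (hbt : b ≠ t) : RevGate W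

namespace RevGate

variable {W : Type} {N : ℕ} (σ : W ≃ Fin N)


/-- The implementation of a reversible gate on the qubits assigned to the wires. -/
def circuit : RevGate W → Circuit N
  | cx a t h => Circuit.cnot (σ a) (σ t) (σ.injective.ne h)
  | ccx a b t hab hat hbt => Circuit.ccx (σ a) (σ b) (σ t) (σ.injective.ne hab)
      (σ.injective.ne hat) (σ.injective.ne hbt)

theorem length_circuit_le (g : RevGate W) : (g.circuit σ).length ≤ 50 := by
  cases g <;> simp [circuit, Circuit.cnot, Circuit.ccx, Circuit.ccz, Circuit.tPow]

theorem width_of_mem_circuit (g : RevGate W) : ∀ k ∈ g.circuit σ, k.width ≤ 2 := by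
  cases g <;> simp [circuit, Circuit.cnot, Circuit.ccx, Circuit.ccz, Circuit.tPow, or_imp,
    Gate.width, forall_and]

theorem length_flatMap_circuit_le (l : List (RevGate W)) :
    (l.flatMap (circuit σ)).length ≤ 50 * l.length := by
  induction l with
  | nil => simp
  | cons g l ih =>
    have := length_circuit_le σ g
    simp only [List.flatMap_cons, List.length_append, List.length_cons]
    omega

theorem width_of_mem_flatMap_circuit (l : List (RevGate W)) :
    ∀ k ∈ l.flatMap (circuit σ), k.width ≤ 2 := by
  intro k hk
  obtain ⟨g, -, hg⟩ := List.mem_flatMap.1 hk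
  exact width_of_mem_circuit σ g k hg

variable [DecidableEq W]

/-- The action of a reversible gate on assignments of bits to the wires. -/
def act : RevGate W → (W → Bool) → (W → Bool)
  | cx a t _, s => Function.update s t (xor (s t) (s a))
  | ccx a b t _ _ _, s => Function.update s t (xor (s t) (s a && s b))

theorem act_act (g : RevGate W) (s : W → Bool) : g.act (g.act s) = s := by
  cases g with
  | cx a t h => simp [act, Function.update_of_ne h]
  | ccx a b t hab hat hbt => simp [act, Function.update_of_ne hat, Function.update_of_ne hbt]

/-- The action of a list of reversible gates; the head is applied first. -/
def run : List (RevGate W) → (W → Bool) → (W → Bool)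
  | [], s => s
  | g :: l, s => run l (g.act s)

theorem run_append (l l' : List (RevGate W)) (s : W → Bool) :
    run (l ++ l') s = run l' (run l s) := by
  induction l generalizing s with
  | nil => rfl
  | cons g l ih => exact ih _

/-- Each gate is an involution, so the reversed list uncomputes. -/
theorem run_reverse_run (l : List (RevGate W)) (s : W → Bool) : run l.reverse (run l s) = s := by
  induction l generalizing s with
  | nil => rfl
  | cons g l ih =>
    rw [List.reverse_cons, run_append]
    change g.act (run l.reverse (run l (g.act s))) = s
    rw [ih, act_act]

theorem op_circuit_mulVec_ket (g : RevGate W) (s : W → Bool) :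
    Circuit.op (g.circuit σ) *ᵥ ket (s ∘ σ.symm) = ket (g.act s ∘ σ.symm) := by
  cases g <;> simp [circuit, Circuit.op_cnot_mulVec_ket, Circuit.op_ccx_mulVec_ket, act,
    Function.update_comp_equiv]

theorem op_flatMap_circuit_mulVec_ket (l : List (RevGate W)) (s : W → Bool) :
    Circuit.op (l.flatMap (circuit σ)) *ᵥ ket (s ∘ σ.symm) = ket (run l s ∘ σ.symm) := by
  induction l generalizing s with
  | nil => simp [Circuit.op_nil_mulVec, run]
  | cons g l ih => rw [List.flatMap_cons, Circuit.op_append_mulVec, op_circuit_mulVec_ket, ih, run]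

end RevGate

/-! ### Circuits acting as an operator on the data while preserving the encoding. -/

section Implements

variable {n m : ℕ}

theorem tensor_ket_ket (y : Bits n) (x : Bits m) : tensor (ket y) (ket x) = ket (Fin.append y x) := by
  ext z
  have : z = Fin.append y x ↔
      (fun i => z (Fin.castAdd m i)) = y ∧ (fun j => z (Fin.natAdd n j)) = x := by
    constructor
    · rintro rfl; simp
    · rintro ⟨rfl, rfl⟩; exact Fin.append_castAdd_natAdd.symm
  simp only [tensor, ket, Pi.single_apply, this]
  split_ifs <;> simp_all

theorem tensor_add (v v' : StateVec n) (w : StateVec m) :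
    tensor (v + v') w = tensor v w + tensor v' w := by
  ext z; simp [tensor, add_mul]

theorem tensor_smul (a : ℂ) (v : StateVec n) (w : StateVec m) :
    tensor (a • v) w = a • tensor v w := by
  ext z; simp [tensor, mul_assoc]

/-- `v ↦ v ⊗ w` as a linear map. -/
def tensorRight (w : StateVec m) : StateVec n →ₗ[ℂ] StateVec (n + m) where
  toFun v := tensor v w
  map_add' v v' := tensor_add v v' w
  map_smul' a v := tensor_smul a v w

theorem append_update_left (y : Bits n) (x : Bits m) (i : Fin n) (b : Bool) :
    Fin.append (Function.update y i b) x = Function.update (Fin.append y x) (Fin.castAdd m i) b := by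
  ext k
  refine Fin.addCases (fun j => ?_) (fun j => ?_) k
  · by_cases h : j = i
    · subst h; simp
    · simp [h]
  · have h' : Fin.natAdd n j ≠ Fin.castAdd m i := by
      simp only [ne_eq, Fin.ext_iff, Fin.val_natAdd, Fin.val_castAdd]; omega
    simp [h']

theorem tensor_slice_ket (y : Bits n) (i : Fin n) (u : Bool → ℂ) (x : Bits m) :
    tensor (slice y i u) (ket x) = slice (Fin.append y x) (Fin.castAdd m i) u := by
  simp only [slice, Fintype.sum_bool, tensor_add, tensor_smul, tensor_ket_ket, append_update_left]

/-- With encoding `x`, the circuit `W` acts on the data qubits as the operator `A`. -/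
def Implements (x : Bits m) (W : Circuit (n + m)) (A : Operator n) : Prop :=
  ∀ v : StateVec n, Circuit.op W *ᵥ tensor v (ket x) = tensor (A *ᵥ v) (ket x)

/-- Both sides are linear in the data state. Quantifying over all states in `Implements` is what
makes it composable, as Hadamard gates produce superpositions. -/
theorem implements_of_ket {x : Bits m} {W : Circuit (n + m)} {A : Operator n}
    (h : ∀ y, Circuit.op W *ᵥ ket (Fin.append y x) = tensor (A *ᵥ ket y) (ket x)) :
    Implements x W A := by
  have : (Matrix.mulVecLin (Circuit.op W)) ∘ₗ tensorRight (ket x) =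
      tensorRight (ket x) ∘ₗ Matrix.mulVecLin A := by
    refine (Pi.basisFun ℂ (Bits n)).ext fun y => ?_
    have hy := h y
    rw [← tensor_ket_ket] at hy
    simpa [tensorRight, ket] using hy
  intro v
  simpa [tensorRight] using LinearMap.congr_fun this v

theorem Implements.nil (x : Bits m) : Implements x ([] : Circuit (n + m)) 1 := by
  intro v; simp [Circuit.op_nil_mulVec]

theorem Implements.append {x : Bits m} {W W' : Circuit (n + m)} {A A' : Operator n}
    (h : Implements x W A) (h' : Implements x W' A') : Implements x (W ++ W') (A' * A) := by
  intro v
  rw [Circuit.op_append_mulVec, h, h', Matrix.mulVec_mulVec]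

theorem implements_flatMap_one {x : Bits m} {α : Type} (l : List α) (f : α → Circuit (n + m))
    (h : ∀ i ∈ l, Implements x (f i) 1) : Implements x (l.flatMap f) 1 := by
  induction l with
  | nil => exact .nil x
  | cons i l ih =>
    rw [List.flatMap_cons]
    simpa using (h i (by simp)).append (ih fun k hk => h k (by simp [hk]))

/-- Used for a row of slots of which exactly one, that of qubit `i`, is active. -/
theorem implements_flatMap {x : Bits m} {α : Type} [DecidableEq α] (l : List α) (hl : l.Nodup)
    (f : α → Circuit (n + m)) (i : α) (hi : i ∈ l) (A : Operator n)
    (h : ∀ k ∈ l, Implements x (f k) (if i = k then A else 1)) : Implements x (l.flatMap f) A := by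
  induction l with
  | nil => simp at hi
  | cons k l ih =>
    rw [List.nodup_cons] at hl
    rw [List.flatMap_cons]
    have hk := h k (by simp)
    by_cases hik : i = k
    · subst hik
      have h1 : Implements x (l.flatMap f) 1 := by
        refine implements_flatMap_one l f fun k hk => ?_
        have hne : i ≠ k := by rintro rfl; exact hl.1 hk
        simpa [hne] using h k (by simp [hk])
      simpa using hk.append h1
    · have hil : i ∈ l := by simpa [hik] using hi
      simpa [hik] using hk.append (ih hl.2 hil fun k' hk' => h k' (by simp [hk']))

end Implements


/-! ### Wires and the encoding of a circuit. -/

/-- The encoding and ancilla wires. For each time step `j` and data qubit `i` there are bits saying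
whether a Hadamard gate is on `i`, whether a `π/8` gate is on `i`, whether `i` is *not* a control of
a Toffoli gate, and whether `i` is the target of a Toffoli gate. -/
inductive Anc (n c : ℕ) : Type
  | had (j : Fin c) (i : Fin n)
  | tee (j : Fin c) (i : Fin n)
  | nonctrl (j : Fin c) (i : Fin n)
  | target (j : Fin c) (i : Fin n)
  | lit (i : Fin n)
  | chain (k : Fin (n + 1))
  | scratch
  deriving DecidableEq, Fintype

/-- The number of encoding and ancilla qubits. -/
def numAnc (n c : ℕ) : ℕ := Fintype.card (Anc n c)

/-- The position of an encoding or ancilla wire. -/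
def ancEquiv (n c : ℕ) : Anc n c ≃ Fin (numAnc n c) := Fintype.equivFin _

/-- Data, encoding and ancilla wires. -/
abbrev Wire (n c : ℕ) : Type := Fin n ⊕ Anc n c

/-- The position of a wire. -/
def wireEquiv (n c : ℕ) : Wire n c ≃ Fin (n + numAnc n c) :=
  (Equiv.sumCongr (Equiv.refl _) (ancEquiv n c)).trans finSumFinEquiv

variable {n c : ℕ}

/-- Is the optional gate a Hadamard gate on qubit `i`? -/
def isHadamard (g : Option (Gate n)) (i : Fin n) : Bool :=
  match g with
  | some (.hadamard k) => decide (k = i)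
  | _ => false

/-- Is the optional gate a `π/8` gate on qubit `i`? -/
def isPiEighth (g : Option (Gate n)) (i : Fin n) : Bool :=
  match g with
  | some (.piEighth k) => decide (k = i)
  | _ => false

/-- Is qubit `i` not a control of the optional Toffoli gate? -/
def isNonctrl (g : Option (Gate n)) (i : Fin n) : Bool :=
  match g with
  | some (.toffoli S _ _ _) => decide (i ∉ S)
  | _ => true

/-- Is qubit `i` the target of the optional Toffoli gate? -/
def isTarget (g : Option (Gate n)) (i : Fin n) : Bool :=
  match g with
  | some (.toffoli _ t _ _) => decide (t = i)
  | _ => false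

/-- The initial value of the encoding and ancilla wires for a sequence of optional gates. -/
def encode (g : Fin c → Option (Gate n)) : Anc n c → Bool
  | .had j i => isHadamard (g j) i
  | .tee j i => isPiEighth (g j) i
  | .nonctrl j i => isNonctrl (g j) i
  | .target j i => isTarget (g j) i
  | .lit _ => false
  | .chain k => decide (k = 0)
  | .scratch => false

/-- The bit string encoding a sequence of optional gates. -/
def encodeBits (g : Fin c → Option (Gate n)) : Bits (numAnc n c) := encode g ∘ (ancEquiv n c).symm

theorem append_eq_comp (y : Bits n) (a : Anc n c → Bool) :
    Fin.append y (a ∘ (ancEquiv n c).symm) = Sum.elim y a ∘ (wireEquiv n c).symm := by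
  ext k
  refine Fin.addCases (fun j => ?_) (fun j => ?_) k <;> simp [wireEquiv]

theorem wireEquiv_inl (i : Fin n) : wireEquiv n c (.inl i) = Fin.castAdd _ i := by
  simp [wireEquiv]

/-! ### Slots for Hadamard and π/8 gates. -/

/-- The slot for a Hadamard gate on qubit `i` at time `j`. -/
def hadamardSlot (j : Fin c) (i : Fin n) : Circuit (n + numAnc n c) :=
  Circuit.controlledH (wireEquiv n c (.inr (.had j i))) (wireEquiv n c (.inl i))
    ((wireEquiv n c).injective.ne (by simp))

theorem implements_hadamardSlot (g : Fin c → Option (Gate n)) (j : Fin c) (i : Fin n) :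
    Implements (encodeBits g) (hadamardSlot j i)
      (if isHadamard (g j) i then onQubit hadamardMatrix i else 1) := by
  refine implements_of_ket fun y => ?_
  rw [hadamardSlot, Circuit.op_controlledH_mulVec_ket, encodeBits, append_eq_comp]
  simp only [Function.comp_apply, Equiv.symm_apply_apply, Sum.elim_inr, encode]
  split_ifs with h
  · rw [onQubit_mulVec_ket, onQubit_mulVec_ket, tensor_slice_ket, append_eq_comp, wireEquiv_inl]
    simp [← wireEquiv_inl]
  · rw [Matrix.one_mulVec, tensor_ket_ket, append_eq_comp]

/-- The Toffoli gate putting the conjunction of data qubit `i` and its `π/8` bit on the scratch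
wire. -/
def teeAnd (j : Fin c) (i : Fin n) : RevGate (Wire n c) :=
  .ccx (.inr (.tee j i)) (.inl i) (.inr .scratch) (by simp) (by simp) (by simp)

/-- The slot for a `π/8` gate on qubit `i` at time `j`. -/
def piEighthSlot (j : Fin c) (i : Fin n) : Circuit (n + numAnc n c) :=
  (teeAnd j i).circuit (wireEquiv n c) ++
    (.piEighth (wireEquiv n c (.inr .scratch)) :: (teeAnd j i).circuit (wireEquiv n c))

theorem implements_piEighthSlot (g : Fin c → Option (Gate n)) (j : Fin c) (i : Fin n) :
    Implements (encodeBits g) (piEighthSlot j i)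
      (if isPiEighth (g j) i then onQubit tMatrix i else 1) := by
  refine implements_of_ket fun y => ?_
  rw [piEighthSlot, Circuit.op_append_mulVec, Circuit.op_cons_mulVec, encodeBits, append_eq_comp,
    RevGate.op_circuit_mulVec_ket, Gate.op, onQubit_tMatrix_mulVec_ket, Matrix.mulVec_smul,
    RevGate.op_circuit_mulVec_ket, RevGate.act_act]
  -- The scratch wire starts at 0, so it now holds the conjunction itself; T on it gives the phase
  -- of T on data qubit `i` exactly when the select bit is set.
  have h1 : (RevGate.act (teeAnd j i) (Sum.elim y (encode g)) ∘ (wireEquiv n c).symm)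
      (wireEquiv n c (.inr .scratch)) = (isPiEighth (g j) i && y i) := by
    rw [Function.comp_apply, Equiv.symm_apply_apply, teeAnd, RevGate.act, Function.update_self]
    simp only [Sum.elim_inr, Sum.elim_inl, encode, Bool.false_xor]
  rw [h1]
  split_ifs with h
  · rw [onQubit_tMatrix_mulVec_ket, tensor_smul, tensor_ket_ket, append_eq_comp, h, Bool.true_and]
  · rw [Matrix.one_mulVec, tensor_ket_ket, append_eq_comp]
    rw [Bool.eq_false_iff.2 h, Bool.false_and]
    exact one_smul ℂ _

/-! ### Slot for an unbounded Toffoli gate. -/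

/-- The gates extending the conjunction on the chain wires by the literal of qubit `i`. -/
def literalGates (j : Fin c) (i : Fin n) : List (RevGate (Wire n c)) :=
  [.cx (.inr (.nonctrl j i)) (.inr (.lit i)) (by simp),
   .cx (.inl i) (.inr (.lit i)) (by simp),
   .ccx (.inr (.nonctrl j i)) (.inl i) (.inr (.lit i)) (by simp) (by simp) (by simp),
   .ccx (.inr (.chain i.castSucc)) (.inr (.lit i)) (.inr (.chain i.succ)) (by simp)
     (by simp [Fin.ext_iff]) (by simp)]

/-- The gates computing the conjunctions on the first `k` chain wires. -/
def chainGates (j : Fin c) : (k : ℕ) → k ≤ n → List (RevGate (Wire n c))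
  | 0, _ => []
  | k + 1, hk => chainGates j k (Nat.le_of_succ_le hk) ++ literalGates j ⟨k, hk⟩

/-- The values on the wires when `k` literals have been processed. -/
def chainState (g : Fin c → Option (Gate n)) (j : Fin c) (y : Bits n) (k : ℕ) : Wire n c → Bool
  | .inl i => y i
  | .inr (.lit i) => decide (i.val < k) && (isNonctrl (g j) i || y i)
  | .inr (.chain l) => decide (l.val ≤ k ∧ ∀ i : Fin n, i.val < l.val → isNonctrl (g j) i || y i)
  | .inr a => encode g a

theorem chainState_zero (g : Fin c → Option (Gate n)) (j : Fin c) (y : Bits n) :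
    chainState g j y 0 = Sum.elim y (encode g) := by
  ext w
  rcases w with i | a
  · rfl
  · cases a <;> simp [chainState, encode]
    rename_i k
    rintro rfl
    simp

/-- The literal is a disjunction, obtained as p ∨ q = p ⊕ q ⊕ pq on a wire initially 0. The next
chain wire is also still 0, so the last gate writes the extended conjunction there; chain wire 0
carries the empty conjunction 1. -/
theorem run_literalGates (g : Fin c → Option (Gate n)) (j : Fin c) (y : Bits n) (i : Fin n) :
    RevGate.run (literalGates j i) (chainState g j y i) = chainState g j y (i + 1) := by
  ext w
  simp only [literalGates, RevGate.run, RevGate.act]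
  rcases w with k | a
  · simp [chainState]
  · cases a with
    | lit k =>
      by_cases hk : k = i
      · subst hk
        simp [chainState, encode]
        cases isNonctrl (g j) k <;> cases y k <;> rfl
      · have : k.val ≠ i.val := fun h => hk (Fin.ext h)
        have h' : k.val < i.val + 1 ↔ k.val < i.val := by omega
        simp [chainState, hk, h']
    | chain l =>
      by_cases hl : l = i.succ
      · subst hl
        simp [chainState, encode]
        have hle : (∀ k ≤ i, isNonctrl (g j) k = true ∨ y k = true) ↔
            (∀ k < i, isNonctrl (g j) k = true ∨ y k = true) ∧
              (isNonctrl (g j) i = true ∨ y i = true) := by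
          refine ⟨fun h => ⟨fun k hk => h k hk.le, h i le_rfl⟩, fun h k hk => ?_⟩
          rcases hk.lt_or_eq with hk | rfl
          exacts [h.1 k hk, h.2]
        rw [Bool.eq_iff_iff, decide_eq_true_iff, hle]
        cases isNonctrl (g j) i <;> cases y i <;> simp
      · have : l.val ≠ i.val + 1 := fun h => hl (Fin.ext h)
        have h' : l.val ≤ i.val + 1 ↔ l.val ≤ i.val := by omega
        simp [chainState, hl, h']
    | _ => simp [chainState]

theorem run_chainGates (g : Fin c → Option (Gate n)) (j : Fin c) (y : Bits n) (k : ℕ) (hk : k ≤ n) :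
    RevGate.run (chainGates j k hk) (Sum.elim y (encode g)) = chainState g j y k := by
  induction k with
  | zero => rw [chainState_zero]; rfl
  | succ k ih => rw [chainGates, RevGate.run_append, ih, run_literalGates g j y ⟨k, hk⟩]

/-- The gate flipping qubit `i` if it is the target and the last chain wire is set. -/
def flipGate (j : Fin c) (i : Fin n) : RevGate (Wire n c) :=
  .ccx (.inr (.chain (Fin.last n))) (.inr (.target j i)) (.inl i) (by simp) (by simp) (by simp)

theorem run_flipGates (j : Fin c) (l : List (Fin n)) (hl : l.Nodup) (s : Wire n c → Bool) :
    RevGate.run (l.map (flipGate j)) s = Sum.elim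
      (fun i => if i ∈ l then
        xor (s (.inl i)) (s (.inr (.chain (Fin.last n))) && s (.inr (.target j i))) else s (.inl i))
      (fun a => s (.inr a)) := by
  induction l generalizing s with
  | nil => ext w; cases w <;> simp [RevGate.run]
  | cons k l ih =>
    rw [List.nodup_cons] at hl
    rw [List.map_cons, RevGate.run, ih hl.2]
    ext w
    rcases w with i | a
    · by_cases hi : i = k
      · subst hi; simp [flipGate, RevGate.act, hl.1]
      · simp [flipGate, RevGate.act, hi]
    · simp [flipGate, RevGate.act]

/-- The gates of the slot for an unbounded Toffoli gate at time `j`. -/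
def toffoliGates (j : Fin c) : List (RevGate (Wire n c)) :=
  chainGates j n le_rfl ++ ((List.finRange n).map (flipGate j) ++ (chainGates j n le_rfl).reverse)

/-- The action of an optional Toffoli gate on bit strings. -/
def toffoliAct (g : Option (Gate n)) (y : Bits n) : Bits n :=
  match g with
  | some (.toffoli S t _ _) => toffoliMap S t y
  | _ => y

/-- After the flip, the work wires must still be what the chain would compute from the new data;
otherwise running it backwards would not clear them. -/
theorem run_flipGates_chainState (g : Fin c → Option (Gate n)) (j : Fin c) (y : Bits n) :
    RevGate.run ((List.finRange n).map (flipGate j)) (chainState g j y n) =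
      chainState g j (toffoliAct (g j) y) n := by
  rw [run_flipGates j _ (List.nodup_finRange n)]
  ext w
  rcases hg : g j with _ | (k | k | ⟨S, t, hS, ht⟩)
  iterate 3
    rcases w with i | a
    · simp [chainState, encode, hg, isTarget, toffoliAct]
    · cases a <;> simp [chainState, hg, toffoliAct]
  -- The target is not a control, so its literal is true whatever its data bit; no literal notices
  -- the flip.
  have hlit : ∀ i, (isNonctrl (g j) i || toffoliMap S t y i) = (isNonctrl (g j) i || y i) := by
    intro i
    by_cases hi : i = t
    · subst hi; simp [hg, isNonctrl, ht]
    · simp [toffoliMap, hi]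
  rcases w with i | a
  · by_cases hi : i = t
    · subst hi
      simp [chainState, encode, hg, isTarget, isNonctrl, toffoliAct, toffoliMap,
        or_iff_not_imp_left]
    · have hi' : t ≠ i := Ne.symm hi
      simp [chainState, encode, hg, isTarget, toffoliAct, toffoliMap, hi, hi']
  · rw [hg] at hlit
    cases a <;> simp [chainState, hg, toffoliAct, hlit]

theorem run_toffoliGates (g : Fin c → Option (Gate n)) (j : Fin c) (y : Bits n) :
    RevGate.run (toffoliGates j) (Sum.elim y (encode g)) =
      Sum.elim (toffoliAct (g j) y) (encode g) := by
  rw [toffoliGates, RevGate.run_append, RevGate.run_append, run_chainGates,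
    run_flipGates_chainState, ← run_chainGates g j _ n le_rfl, RevGate.run_reverse_run]

/-- The slot for an unbounded Toffoli gate at time `j`. -/
def toffoliSlot (j : Fin c) : Circuit (n + numAnc n c) :=
  (toffoliGates j).flatMap (RevGate.circuit (wireEquiv n c))

theorem op_toffoliSlot_mulVec_ket (g : Fin c → Option (Gate n)) (j : Fin c) (y : Bits n) :
    Circuit.op (toffoliSlot j) *ᵥ ket (Fin.append y (encodeBits g)) =
      tensor (ket (toffoliAct (g j) y)) (ket (encodeBits g)) := by
  rw [tensor_ket_ket, encodeBits, append_eq_comp, append_eq_comp, toffoliSlot,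
    RevGate.op_flatMap_circuit_mulVec_ket, run_toffoliGates]

/-! ### One time step and the universal circuit. -/

/-- The circuit performing the gate encoded for time `j`. -/
def stepCircuit (n : ℕ) {c : ℕ} (j : Fin c) : Circuit (n + numAnc n c) :=
  (List.finRange n).flatMap (hadamardSlot j) ++
    ((List.finRange n).flatMap (piEighthSlot j) ++ toffoliSlot j)

/-- The operator of an optional gate. -/
def optionOp (g : Option (Gate n)) : Operator n := g.elim 1 Gate.op

theorem implements_stepCircuit (g : Fin c → Option (Gate n)) (j : Fin c) :
    Implements (encodeBits g) (stepCircuit n j) (optionOp (g j)) := by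
  have hH := implements_hadamardSlot g j
  have hT := implements_piEighthSlot g j
  have hX := op_toffoliSlot_mulVec_ket g j
  rcases hg : g j with _ | (k | k | ⟨S, t, hS, ht⟩)
  · have h1 : Implements (encodeBits g) (toffoliSlot j) 1 :=
      implements_of_ket fun y => by rw [hX, hg]; simp [toffoliAct]
    have := (implements_flatMap_one (List.finRange n) _ fun i _ => by
      simpa [hg, isHadamard] using hH i).append
      ((implements_flatMap_one (List.finRange n) _ fun i _ => by
        simpa [hg, isPiEighth] using hT i).append h1)
    simpa [optionOp, stepCircuit] using this
  · have h1 : Implements (encodeBits g) (toffoliSlot j) 1 :=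
      implements_of_ket fun y => by rw [hX, hg]; simp [toffoliAct]
    have := (implements_flatMap (List.finRange n) (List.nodup_finRange n) _ k (List.mem_finRange k)
      (onQubit hadamardMatrix k) fun i _ => by
        have h := hH i
        rw [hg] at h
        by_cases hk : k = i
        · subst hk; simpa [isHadamard] using h
        · simpa [isHadamard, hk] using h).append
      ((implements_flatMap_one (List.finRange n) _ fun i _ => by
        simpa [hg, isPiEighth] using hT i).append h1)
    simpa [optionOp, Gate.op, stepCircuit] using this
  · have h1 : Implements (encodeBits g) (toffoliSlot j) 1 :=
      implements_of_ket fun y => by rw [hX, hg]; simp [toffoliAct]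
    have := (implements_flatMap_one (List.finRange n) _ fun i _ => by
      simpa [hg, isHadamard] using hH i).append
      ((implements_flatMap (List.finRange n) (List.nodup_finRange n) _ k (List.mem_finRange k)
        (onQubit tMatrix k) fun i _ => by
          have h := hT i
          rw [hg] at h
          by_cases hk : k = i
          · subst hk; simpa [isPiEighth] using h
          · simpa [isPiEighth, hk] using h).append h1)
    simpa [optionOp, Gate.op, stepCircuit] using this
  · have h1 : Implements (encodeBits g) (toffoliSlot j) (toffoliOp S t) :=
      implements_of_ket fun y => by rw [hX, hg, toffoliOp_mulVec_ket]; simp [toffoliAct]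
    have := (implements_flatMap_one (List.finRange n) _ fun i _ => by
      simpa [hg, isHadamard] using hH i).append
      ((implements_flatMap_one (List.finRange n) _ fun i _ => by
        simpa [hg, isPiEighth] using hT i).append h1)
    simpa [optionOp, Gate.op, stepCircuit] using this

/-- The universal circuit for circuits of size at most `c` on `n` qubits. -/
def universalCircuit (n c : ℕ) : Circuit (n + numAnc n c) :=
  (List.finRange c).flatMap (stepCircuit n)

theorem implements_flatMap_stepCircuit (C : Circuit n) (g : Fin c → Option (Gate n))
    (l : List (Fin c)) (hl : l.map g = C.map some ++ List.replicate (l.length - C.length) none) :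
    Implements (encodeBits g) (l.flatMap (stepCircuit n)) (Circuit.op C) := by
  induction l generalizing C with
  | nil =>
    have : C = [] := by simpa using hl
    subst this
    exact .nil _
  | cons j l ih =>
    rw [List.flatMap_cons]
    have hj := implements_stepCircuit g j
    cases C with
    | nil =>
      simp only [List.map_cons, List.map_nil, List.nil_append, List.length_cons, List.length_nil,
        Nat.sub_zero, List.replicate_succ, List.cons.injEq] at hl
      rw [hl.1] at hj
      simpa [optionOp] using hj.append (ih [] (by simpa using hl.2))
    | cons a C =>
      simp only [List.map_cons, List.cons_append, List.length_cons, Nat.add_sub_add_right,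
        List.cons.injEq] at hl
      rw [hl.1] at hj
      exact hj.append (ih C hl.2)

theorem isUniversal_universalCircuit (n c : ℕ) :
    IsUniversal (universalCircuit n c) {C : Circuit n | Circuit.size C ≤ c} := by
  intro C hC
  have hC : C.length ≤ c := hC
  -- Lookup beyond the end of `C` yields `none`, which supplies the padding by identity steps.
  let g : Fin c → Option (Gate n) := fun j => C[j.val]?
  refine ⟨encodeBits g, fun y => implements_flatMap_stepCircuit C g (List.finRange c) ?_ (ket y)⟩
  apply List.ext_getElem?
  intro k
  by_cases hk : k < c
  · by_cases hk' : k < C.length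
    · simp [g, hk, hk', List.getElem?_append]
    · have : k - C.length < c - C.length := by omega
      simp [g, hk, hk', this, List.getElem?_append]
  · have h1 : ¬ k < C.length := by omega
    have h2 : ¬ k - C.length < c - C.length := by omega
    simp [hk, h1, h2, List.getElem?_append]

/-! ### Gate count and gate widths. -/

theorem length_flatMap_le {α β : Type} (l : List α) (f : α → List β) (b : ℕ)
    (h : ∀ a, (f a).length ≤ b) : (l.flatMap f).length ≤ l.length * b := by
  induction l with
  | nil => simp
  | cons a l ih =>
    have := h a
    simp only [List.flatMap_cons, List.length_append, List.length_cons, Nat.add_mul, one_mul]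
    omega

theorem length_chainGates (j : Fin c) (k : ℕ) (hk : k ≤ n) : (chainGates j k hk).length = 4 * k := by
  induction k with
  | zero => rfl
  | succ k ih => rw [chainGates, List.length_append, ih]; simp [literalGates]; omega

theorem length_stepCircuit_le (j : Fin c) : (stepCircuit n j).length ≤ n * 1000 := by
  -- Per qubit: at most 30 for the Hadamard slot, 50 + 1 + 50 for the π/8 slot, and 50 · (4 + 1 + 4)
  -- for chain, flip and reversed chain; the sum 581 is below 1000.
  have h1 := length_flatMap_le (List.finRange n) (hadamardSlot j) 30
    fun i => by simp [hadamardSlot, Circuit.controlledH, Circuit.tPow, Circuit.cnot]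
  have h2 := length_flatMap_le (List.finRange n) (piEighthSlot j) 101 fun i => by
    have := RevGate.length_circuit_le (wireEquiv n c) (teeAnd j i)
    simp only [piEighthSlot, List.length_append, List.length_cons]
    omega
  have h3 := RevGate.length_flatMap_circuit_le (wireEquiv n c) (toffoliGates j)
  simp only [toffoliGates, List.length_append, List.length_reverse, List.length_map,
    length_chainGates, List.length_finRange] at h1 h2 h3
  simp only [stepCircuit, List.length_append, toffoliSlot, toffoliGates]
  omega

theorem length_universalCircuit_le (n c : ℕ) : (universalCircuit n c).length ≤ 1000 * (n * c) := by
  have := length_flatMap_le (List.finRange c) (stepCircuit n) _ length_stepCircuit_le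
  rw [List.length_finRange] at this
  rw [universalCircuit]
  linarith

theorem width_of_mem_universalCircuit (n c : ℕ) : ∀ g ∈ universalCircuit n c, g.width ≤ 2 := by
  intro g hg
  obtain ⟨j, -, hg⟩ := List.mem_flatMap.1 hg
  rw [stepCircuit, List.mem_append, List.mem_append] at hg
  rcases hg with hg | hg | hg
  · obtain ⟨i, -, hg⟩ := List.mem_flatMap.1 hg
    simp only [hadamardSlot, Circuit.controlledH, Circuit.tPow, Circuit.cnot, List.mem_append,
      List.mem_cons, List.mem_replicate, List.not_mem_nil, or_false] at hg
    rcases hg with ⟨-, rfl⟩ | rfl | ⟨-, rfl⟩ | rfl | ⟨-, rfl⟩ | rfl | ⟨-, rfl⟩ <;> simp [Gate.width]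
  · obtain ⟨i, -, hg⟩ := List.mem_flatMap.1 hg
    rw [piEighthSlot, List.mem_append, List.mem_cons] at hg
    rcases hg with hg | rfl | hg
    · exact RevGate.width_of_mem_circuit _ _ g hg
    · simp [Gate.width]
    · exact RevGate.width_of_mem_circuit _ _ g hg
  · exact RevGate.width_of_mem_flatMap_circuit _ _ g hg

end QCircuit

end

theorem corollary1 :
    ∃ (m : ℕ → ℕ → ℕ) (U : (n c : ℕ) → QCircuit.Circuit (n + m n c)) (K : ℝ),
      ∀ n c : ℕ, 0 < n → 0 < c →
        QCircuit.IsUniversal (U n c) {C : QCircuit.Circuit n | QCircuit.Circuit.size C ≤ c} ∧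
        (∀ g ∈ U n c, g.width ≤ 2) ∧
        (2 ≤ n * c →
          (QCircuit.Circuit.size (U n c) : ℝ) ≤ K * ((n * c : ℕ) : ℝ) * Real.log ((n * c : ℕ) : ℝ)) := by
  -- The size is at most 1000nc; as nc ≥ 2 gives log(nc) ≥ log 2, dividing the constant by log 2
  -- absorbs the logarithm.
  refine ⟨QCircuit.numAnc, QCircuit.universalCircuit, 1000 / Real.log 2, fun n c _ _ =>
    ⟨QCircuit.isUniversal_universalCircuit n c, QCircuit.width_of_mem_universalCircuit n c,
      fun hnc => ?_⟩⟩
  have h2 : 0 < Real.log 2 := Real.log_pos (by norm_num)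
  have hlog : Real.log 2 ≤ Real.log ((n * c : ℕ) : ℝ) :=
    Real.log_le_log (by norm_num) (by exact_mod_cast hnc)
  have hlen : (QCircuit.Circuit.size (QCircuit.universalCircuit n c) : ℝ) ≤
      1000 * ((n * c : ℕ) : ℝ) := by
    exact_mod_cast QCircuit.length_universalCircuit_le n c
  calc (QCircuit.Circuit.size (QCircuit.universalCircuit n c) : ℝ)
      ≤ 1000 * ((n * c : ℕ) : ℝ) := hlen
    _ = 1000 / Real.log 2 * ((n * c : ℕ) : ℝ) * Real.log 2 := by field_simp
    _ ≤ _ := by gcongr
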